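/- Let $1\le N_T\le N_R$ be integers, $N=N_R-N_T+1$, and $\Gamma_1>0$. Let $A_n(\sigma)=\frac{(N)_n}{(N_R)_n}\frac{\sigma^n}{n!}$ with $(k)_n=k(k+1)\cdots(k+n-1)$, and let ${}_1F_1(N;N_R;\sigma)=\sum_{n\ge 0}A_n(\sigma)$ be the confluent hypergeometric function. The zero-forcing (ZF) SNR $\gamma_1$ under Rician--Rayleigh fading has, for $a\ge 0$, the moment generating function $$M_{\gamma_1}(s,a)=\frac{1}{(1-\Gamma_1 s)^{N}}\;{}_1F_1\!\Big(N;N_R;\frac{a\,\Gamma_1 s}{1-\Gamma_1 s}\Big),\qquad s<1/\Gamma_1 ,$$ and we put $$p_{\gamma_1}(t,a)=\sum_{n=0}^{\infty}A_n(a)\sum_{m=0}^{n}\binom nm\frac{(-1)^m\,t^{N+n-m-1}e^{-t/\Gamma_1}}{(N+n-m-1)!\;\Gamma_1^{N+n-m}} .$$ Call a function $f(x,y)$ on a set $D$ holonomic with respect to $x$ if there are $r\ge 0$ and polynomials $c_0,\dots,c_r$ in $(x,y)$ such that, at every point of $D$, $f$ is $r$ times continuously differentiable in $x$ with $\sum_{i=0}^{r}c_i(x,y)\,\partial_x^i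 f(x,y)=0$, and such that for every $y$ occurring in $D$ the polynomial $c_r(\cdot,y)$ is not identically zero; holonomic with respect to $y$ is defined in the same way with the variables exchanged. Then, both over $\mathbb R$ and over $\mathbb C$: 1. $M_{\gamma_1}(s,a)$, given by the formula above for all $(s,a)$ with $\Gamma_1 s\ne 1$, is holonomic with respect to both $s$ and $a$. 2. $p_{\gamma_1}(t,a)$ is holonomic with respect to both $t$ and $a$, on all $(t,a)$. Moreover, $p_{\gamma_1}(\cdot,a)$ is indeed the p.d.f. that belongs to this m.g.f.: for every real $a\ge 0$ one has $p_{\gamma_1}(t,a)\ge 0$ for $t>0$, and a measure $\mu$ on $\mathbb R$ is a probability measure with $\int e^{st}\,\mathrm d\mu(t)=M_{\gamma_1}(s,a)$ (integrable) for all real $s<1/\Gamma_1$ if and only if $\mu$ has the density $p_{\gamma_1}(t,a)$ on $(0,\infty)$ and no mass elsewhere. -/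

import Mathlib

open MeasureTheory ProbabilityTheory

/-- The function `f (x, y)` is holonomic with respect to its first variable on `D`: there is a
single linear differential equation in `x`, with coefficients polynomial in `x` and `y`, that holds
at every point of `D`, and for every `y` that occurs in `D` its leading coefficient is not the zero
polynomial in `x`. The derivatives involved are required to exist. -/
def IsHolonomicFst {𝕜 : Type*} [NontriviallyNormedField 𝕜] (f : 𝕜 → 𝕜 → 𝕜) (D : Set (𝕜 × 𝕜)) :
    Prop :=
  ∃ (r : ℕ) (c : ℕ → MvPolynomial (Fin 2) 𝕜), ∀ x y : 𝕜, (x, y) ∈ D →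
    (∃ x' : 𝕜, MvPolynomial.eval ![x', y] (c r) ≠ 0) ∧
    ContDiffAt 𝕜 r (fun x' => f x' y) x ∧
    ∑ i ∈ Finset.range (r + 1),
      MvPolynomial.eval ![x, y] (c i) * iteratedDeriv i (fun x' => f x' y) x = 0

/-- Holonomic on `D` with respect to each of the two variables. -/
def IsHolonomic {𝕜 : Type*} [NontriviallyNormedField 𝕜] (f : 𝕜 → 𝕜 → 𝕜) (D : Set (𝕜 × 𝕜)) :
    Prop :=
  IsHolonomicFst f D ∧ IsHolonomicFst (fun y x => f x y) (Prod.swap ⁻¹' D)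

/-- The term `A_n(σ) = (N)_n / (N_R)_n * σ ^ n / n!` of the confluent hypergeometric series;
`k.ascFactorial n` is the Pochhammer symbol `(k)_n = k (k + 1) ⋯ (k + n - 1)`. -/
noncomputable def kummerTerm {𝕜 : Type*} [NontriviallyNormedField 𝕜] (N NR n : ℕ) (σ : 𝕜) : 𝕜 :=
  (N.ascFactorial n : 𝕜) / (NR.ascFactorial n : 𝕜) * (σ ^ n / (n.factorial : 𝕜))

/-- The confluent hypergeometric function `₁F₁(N; N_R; σ)`. -/
noncomputable def kummer {𝕜 : Type*} [NontriviallyNormedField 𝕜] (N NR : ℕ) (σ : 𝕜) : 𝕜 :=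
  ∑' n : ℕ, kummerTerm N NR n σ

/-- The moment generating function `M_{γ₁}(s, a)` of the zero-forcing SNR. -/
noncomputable def zfMgf {𝕜 : Type*} [NontriviallyNormedField 𝕜] (N NR : ℕ) (Γ₁ s a : 𝕜) : 𝕜 :=
  1 / (1 - Γ₁ * s) ^ N * kummer N NR (a * (Γ₁ * s / (1 - Γ₁ * s)))

/-- The (everywhere convergent) series for the probability density `p_{γ₁}(t, a)`, `t > 0`, of the
zero-forcing SNR. -/
noncomputable def zfPdf {𝕜 : Type*} [RCLike 𝕜] (N NR : ℕ) (Γ₁ t a : 𝕜) : 𝕜 :=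
  ∑' n : ℕ, kummerTerm N NR n a * ∑ m ∈ Finset.range (n + 1),
    (n.choose m : 𝕜) * ((-1) ^ m * t ^ (N + n - m - 1) * NormedSpace.exp (-t / Γ₁) /
      (((N + n - m - 1).factorial : 𝕜) * Γ₁ ^ (N + n - m)))

/-- `μ` is a law of the zero-forcing SNR: a probability distribution whose moment generating
function exists for `s < 1 / Γ₁` and equals `M_{γ₁}(s, a)` there. -/
def IsZfSnrLaw (N NR : ℕ) (Γ₁ a : ℝ) (μ : Measure ℝ) : Prop :=
  IsProbabilityMeasure μ ∧ ∀ s : ℝ, s < 1 / Γ₁ →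
    Integrable (fun t => Real.exp (s * t)) μ ∧ mgf id μ s = zfMgf N NR Γ₁ s a

/-! Every function involved reduces to a power series with coefficients bounded by `B * R ^ n / n!`.
Such a series is entire and may be differentiated termwise, so a linear ODE with polynomial
coefficients follows from a recurrence for its coefficients. Kummer's equation, of order 2, settles
the m.g.f.: in `a` it is rescaled by `u = Γs/(1 - Γs)`, and in `s` it is pulled back along `a * u`
and multiplied by `(1 - Γs)^(-N)`.

The inner sum of the density is the `n`-th forward difference in `k`, at `k = 0`, of the gamma
densities of shape `N + k`. As these satisfy a first-order recurrence in `k`, the differences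
satisfy a three-term one (`erlangDiff_recurrence`). Combined with the recurrence for the Kummer
coefficients it yields an ODE of order 3 in `a`. For `t` the double series is rearranged into gamma
densities weighted by `₁F₁(N + k; N_R + k; -a)` (`zfPdf_eq_tsum_kummer`). Contiguity of these values
gives an ODE of order 3 for the density divided by `t^(N-1) exp(-t/Γ)`.

The same rearrangement shows nonnegativity, since `₁F₁(p; q; -y) ≥ 0` for `0 < p ≤ q` and `y ≥ 0`.
The Laplace transform is computed term by term: differencing turns `(1 - Γs)^(-N-k)` into `(1 -
Γs)^(-N) u^n`. A law is determined by its m.g.f. near `0`, by analytic continuation to the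
characteristic function. -/

/-! ### Power series with coefficients of factorial decay -/

section FactorialDecay

variable {𝕜 : Type*} [RCLike 𝕜]

/-- The coefficients `c n` are bounded by `B * R ^ n / n!`, so that `∑ c n * x ^ n` is an entire
function of exponential type. -/
def FactorialDecay (c : ℕ → 𝕜) : Prop :=
  ∃ B R : ℝ, 0 ≤ R ∧ ∀ n, ‖c n‖ ≤ B * (R ^ n / n.factorial)

/-- The sum of the power series with coefficients `c`. -/
noncomputable def seriesSum (c : ℕ → 𝕜) (x : 𝕜) : 𝕜 := ∑' n, c n * x ^ n

/-- The coefficients of the derivative of a power series. -/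
def derivCoeff (c : ℕ → 𝕜) (n : ℕ) : 𝕜 := (n + 1) * c (n + 1)

/-- The coefficients of `x` times a power series. -/
def shiftCoeff (c : ℕ → 𝕜) : ℕ → 𝕜
  | 0 => 0
  | n + 1 => c n

variable {c : ℕ → 𝕜}

theorem FactorialDecay.norm_derivCoeff_le {B R : ℝ}
    (h : ∀ n, ‖c n‖ ≤ B * (R ^ n / n.factorial)) (n : ℕ) :
    ‖derivCoeff c n‖ ≤ B * R * (R ^ n / n.factorial) := by
  have h1 : ‖((n : 𝕜) + 1)‖ = (n : ℝ) + 1 := by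
    have := RCLike.norm_natCast (K := 𝕜) (n + 1)
    push_cast at this
    exact this
  rw [derivCoeff, norm_mul, h1]
  refine (mul_le_mul_of_nonneg_left (h (n + 1)) (by positivity)).trans_eq ?_
  rw [Nat.factorial_succ]
  push_cast
  field_simp
  ring

theorem FactorialDecay.derivCoeff (h : FactorialDecay c) : FactorialDecay (derivCoeff c) := by
  obtain ⟨B, R, hR, h⟩ := h
  exact ⟨B * R, R, hR, norm_derivCoeff_le h⟩

theorem FactorialDecay.summable_norm (h : FactorialDecay c) (x : 𝕜) :
    Summable fun n => ‖c n * x ^ n‖ := by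
  obtain ⟨B, R, hR, h⟩ := h
  refine Summable.of_nonneg_of_le (fun _ => norm_nonneg _) (fun n => ?_)
    ((Real.summable_pow_div_factorial (R * ‖x‖)).mul_left B)
  rw [norm_mul, norm_pow, mul_pow]
  refine (mul_le_mul_of_nonneg_right (h n) (by positivity)).trans_eq ?_
  ring

theorem FactorialDecay.hasSum (h : FactorialDecay c) (x : 𝕜) :
    HasSum (fun n => c n * x ^ n) (seriesSum c x) :=
  (h.summable_norm x).of_norm.hasSum

theorem FactorialDecay.hasDerivAt (h : FactorialDecay c) (x : 𝕜) :
    HasDerivAt (seriesSum c) (seriesSum (_root_.derivCoeff c) x) x := by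
  have hs := h
  obtain ⟨B, R, hR, hb⟩ := h
  set ρ := ‖x‖ + 1
  -- Majorant for the differentiated terms on the ball of radius `‖x‖ + 1`. At `n = 0` the truncated
  -- subtraction gives `B * R`, which dominates the zero term because `0 ≤ B`.
  let u : ℕ → ℝ := fun n => B * R * ((R * ρ) ^ (n - 1) / (n - 1).factorial)
  have hu : Summable u := by
    rw [← summable_nat_add_iff 1]
    exact (Real.summable_pow_div_factorial (R * ρ)).mul_left (B * R)
  have hx : x ∈ Metric.ball (0 : 𝕜) ρ := by simp [ρ]
  have hB : 0 ≤ B := by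
    have := (norm_nonneg _).trans (hb 0)
    simpa using this
  have key := hasDerivAt_tsum_of_isPreconnected (g := fun n (y : 𝕜) => c n * y ^ n)
    (g' := fun n y => c n * (n * y ^ (n - 1))) hu Metric.isOpen_ball
    (convex_ball (0 : 𝕜) ρ).isPreconnected
    (fun n y _ => (hasDerivAt_pow n y).const_mul (c n)) (fun n y hy => ?_) hx
    (hs.summable_norm x).of_norm hx
  · refine (show HasDerivAt (seriesSum c) _ x from key).congr_deriv ?_
    rw [seriesSum, tsum_eq_zero_add' (f := fun n => c n * (n * x ^ (n - 1)))]
    · simp only [_root_.derivCoeff]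
      simp
      exact tsum_congr fun n => by ring
    · refine (hs.derivCoeff.hasSum x).summable.congr fun n => ?_
      simp [_root_.derivCoeff]
      ring
  · cases n with
    | zero => simp [u]; positivity
    | succ n =>
      have h1 := norm_derivCoeff_le hb n
      have hy' : ‖y‖ ≤ ρ := by simpa using (mem_ball_zero_iff.1 hy).le
      have e : c (n + 1) * ((n + 1 : ℕ) * y ^ (n + 1 - 1)) = _root_.derivCoeff c n * y ^ n := by
        simp [_root_.derivCoeff]; ring
      rw [e, norm_mul, norm_pow]
      calc _ ≤ B * R * (R ^ n / n.factorial) * ρ ^ n := by gcongr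
        _ = u (n + 1) := by simp [u, mul_pow]; ring

theorem FactorialDecay.deriv (h : FactorialDecay c) :
    deriv (seriesSum c) = seriesSum (_root_.derivCoeff c) :=
  funext fun x => (h.hasDerivAt x).deriv

theorem FactorialDecay.contDiff (h : FactorialDecay c) (n : ℕ) :
    ContDiff 𝕜 n (seriesSum c) := by
  induction n generalizing c with
  | zero =>
    exact contDiff_zero.2 (continuous_iff_continuousAt.2 fun x => (h.hasDerivAt x).continuousAt)
  | succ n ih =>
    push_cast
    rw [contDiff_succ_iff_deriv]
    refine ⟨fun x => (h.hasDerivAt x).differentiableAt, by simp, ?_⟩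
    rw [h.deriv]
    exact ih h.derivCoeff

theorem FactorialDecay.iteratedDeriv (h : FactorialDecay c) (i : ℕ) :
    iteratedDeriv i (seriesSum c) = seriesSum (_root_.derivCoeff^[i] c) := by
  induction i generalizing c with
  | zero => simp
  | succ i ih => rw [iteratedDeriv_succ', h.deriv, ih h.derivCoeff, Function.iterate_succ_apply]

theorem FactorialDecay.hasSum_shiftCoeff {c : ℕ → 𝕜} {x F : 𝕜}
    (h : HasSum (fun n => c n * x ^ n) F) :
    HasSum (fun n => shiftCoeff c n * x ^ n) (x * F) := by
  rw [← hasSum_nat_add_iff' 1]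
  simp only [shiftCoeff, Finset.range_one, Finset.sum_singleton, zero_mul, sub_zero]
  exact (h.mul_left x).congr_fun fun n => by ring

theorem FactorialDecay.hasSum_natCast_mul (h : FactorialDecay c) (x : 𝕜) :
    HasSum (fun n : ℕ => (n * c n) * x ^ n) (x * seriesSum (_root_.derivCoeff c) x) := by
  convert hasSum_shiftCoeff (h.derivCoeff.hasSum x) using 2 with n
  cases n <;> simp [shiftCoeff, _root_.derivCoeff]

end FactorialDecay

/-! ### The confluent hypergeometric function -/

section Kummer

variable {𝕜 : Type*} [RCLike 𝕜]

theorem Nat.ascFactorial_le_ascFactorial {p q : ℕ} (h : p ≤ q) (n : ℕ) :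
    p.ascFactorial n ≤ q.ascFactorial n := by
  induction n with
  | zero => simp
  | succ n ih => rw [Nat.ascFactorial_succ, Nat.ascFactorial_succ]; gcongr

theorem Nat.ascFactorial_pos_of_pos {q : ℕ} (h : 0 < q) (n : ℕ) : 0 < q.ascFactorial n := by
  induction n with
  | zero => simp
  | succ n ih => rw [Nat.ascFactorial_succ]; positivity

theorem natCast_ascFactorial_ne_zero {q : ℕ} (h : 0 < q) (n : ℕ) :
    (q.ascFactorial n : 𝕜) ≠ 0 :=
  Nat.cast_ne_zero.2 (Nat.ascFactorial_pos_of_pos h n).ne'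

theorem natCast_factorial_ne_zero (n : ℕ) : (n.factorial : 𝕜) ≠ 0 :=
  Nat.cast_ne_zero.2 n.factorial_ne_zero

theorem natCast_add_natCast_ne_zero {q : ℕ} (h : 0 < q) (n : ℕ) : (q + n : 𝕜) ≠ 0 := by
  have : ((q + n : ℕ) : 𝕜) ≠ 0 := Nat.cast_ne_zero.2 (by lia)
  exact_mod_cast this

/-- The coefficients of the confluent hypergeometric series. -/
noncomputable def kummerCoeff (p q n : ℕ) : 𝕜 :=
  (p.ascFactorial n : 𝕜) / (q.ascFactorial n : 𝕜) / (n.factorial : 𝕜)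

theorem kummerTerm_eq (p q n : ℕ) (σ : 𝕜) : kummerTerm p q n σ = kummerCoeff p q n * σ ^ n := by
  rw [kummerTerm, kummerCoeff]; ring

theorem kummer_eq_seriesSum (p q : ℕ) :
    (kummer p q : 𝕜 → 𝕜) = seriesSum (kummerCoeff p q) := by
  ext σ; simp only [kummer, seriesSum, kummerTerm_eq]

theorem norm_kummerCoeff_le {p q : ℕ} (h : p ≤ q) (n : ℕ) :
    ‖(kummerCoeff p q n : 𝕜)‖ ≤ 1 / n.factorial := by
  rw [kummerCoeff, norm_div, norm_div, RCLike.norm_natCast, RCLike.norm_natCast,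
    RCLike.norm_natCast]
  gcongr
  exact div_le_one_of_le₀ (by exact_mod_cast Nat.ascFactorial_le_ascFactorial h n) (by positivity)

theorem norm_kummerTerm_le {p q : ℕ} (h : p ≤ q) (n : ℕ) (σ : 𝕜) :
    ‖kummerTerm p q n σ‖ ≤ ‖σ‖ ^ n / n.factorial := by
  rw [kummerTerm_eq, norm_mul, norm_pow]
  refine (mul_le_mul_of_nonneg_right (norm_kummerCoeff_le h n) (by positivity)).trans_eq ?_
  ring

theorem factorialDecay_kummerCoeff {p q : ℕ} (h : p ≤ q) :
    FactorialDecay (kummerCoeff p q : ℕ → 𝕜) :=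
  ⟨1, 1, by simp, fun n => by simpa using norm_kummerCoeff_le (𝕜 := 𝕜) h n⟩

theorem norm_kummer_le {p q : ℕ} (h : p ≤ q) (σ : 𝕜) : ‖kummer p q σ‖ ≤ Real.exp ‖σ‖ := by
  rw [Real.exp_eq_exp_ℝ, NormedSpace.exp_eq_tsum_div]
  exact tsum_of_norm_bounded (Real.summable_pow_div_factorial ‖σ‖).hasSum
    fun n => norm_kummerTerm_le h n σ

theorem kummerCoeff_succ {q : ℕ} (hq : 0 < q) (p n : ℕ) :
    ((n + 1) * ((q + n) * kummerCoeff p q (n + 1)) : 𝕜) = (p + n) * kummerCoeff p q n := by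
  have h1 := natCast_ascFactorial_ne_zero (𝕜 := 𝕜) hq n
  have h2 := natCast_factorial_ne_zero (𝕜 := 𝕜) n
  have h3 := natCast_add_natCast_ne_zero (𝕜 := 𝕜) hq n
  have h4 := Nat.cast_add_one_ne_zero (R := 𝕜) n
  simp only [kummerCoeff, Nat.ascFactorial_succ, Nat.factorial_succ, Nat.cast_mul, Nat.cast_add,
    Nat.cast_one]
  field_simp

theorem derivCoeff_kummerCoeff {q : ℕ} (hq : 0 < q) (p n : ℕ) :
    (derivCoeff (kummerCoeff p q) n : 𝕜) = p / q * kummerCoeff (p + 1) (q + 1) n := by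
  have h1 := natCast_ascFactorial_ne_zero (𝕜 := 𝕜) hq n
  have h1' := natCast_ascFactorial_ne_zero (𝕜 := 𝕜) q.succ_pos n
  have h2 := natCast_factorial_ne_zero (𝕜 := 𝕜) n
  have h3 := natCast_add_natCast_ne_zero (𝕜 := 𝕜) hq n
  have h3' : (q : 𝕜) ≠ 0 := Nat.cast_ne_zero.2 hq.ne'
  have h4 := Nat.cast_add_one_ne_zero (R := 𝕜) n
  have e1 : (p * (p + 1).ascFactorial n : 𝕜) = (p + n) * p.ascFactorial n := by
    exact_mod_cast Nat.succ_ascFactorial p n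
  have e2 : (q * (q + 1).ascFactorial n : 𝕜) = (q + n) * q.ascFactorial n := by
    exact_mod_cast Nat.succ_ascFactorial q n
  have e3 : (p / q * kummerCoeff (p + 1) (q + 1) n : 𝕜) =
      (p * (p + 1).ascFactorial n) / (q * (q + 1).ascFactorial n) / n.factorial := by
    rw [kummerCoeff]
    field_simp
  rw [e3, e1, e2]
  simp only [derivCoeff, kummerCoeff, Nat.ascFactorial_succ, Nat.factorial_succ, Nat.cast_mul,
    Nat.cast_add, Nat.cast_one]
  field_simp

theorem contDiff_kummer {p q : ℕ} (h : p ≤ q) (n : ℕ) : ContDiff 𝕜 n (kummer p q : 𝕜 → 𝕜) := by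
  rw [kummer_eq_seriesSum]
  exact (factorialDecay_kummerCoeff h).contDiff n

/-- Kummer's differential equation for the rescaled series `C * ₁F₁(p; q; u * x)`. -/
theorem seriesSum_kummer_ode {p q : ℕ} (c : ℕ → 𝕜) (u : 𝕜) (hc : FactorialDecay c)
    (hrec : ∀ n : ℕ, (n + 1) * ((q + n) * c (n + 1)) = u * ((p + n) * c n)) (x : 𝕜) :
    x * seriesSum (derivCoeff (derivCoeff c)) x + (q - u * x) * seriesSum (derivCoeff c) x
      - p * u * seriesSum c x = 0 := by
  have h := (((hc.derivCoeff.hasSum_natCast_mul x).add ((hc.derivCoeff.hasSum x).mul_left (q : 𝕜))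
    ).sub ((hc.hasSum_natCast_mul x).mul_left u)).sub ((hc.hasSum x).mul_left (p * u))
  have h0 := h.unique (hasSum_zero.congr_fun fun n => ?_)
  · linear_combination h0
  · simp only [derivCoeff]
    linear_combination x ^ n * hrec n

theorem kummer_ode {p q : ℕ} (hq : 0 < q) (h : p ≤ q) (σ : 𝕜) :
    σ * seriesSum (derivCoeff (derivCoeff (kummerCoeff p q))) σ
      + (q - σ) * seriesSum (derivCoeff (kummerCoeff p q)) σ - p * kummer p q σ = 0 := by
  have := seriesSum_kummer_ode (kummerCoeff p q) 1 (factorialDecay_kummerCoeff h)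
    (fun n => by rw [kummerCoeff_succ hq, one_mul]) σ
  rw [kummer_eq_seriesSum]
  linear_combination this

/-- The contiguous relation that Kummer's equation becomes when the derivatives are expressed by
`₁F₁` with raised parameters. -/
theorem kummer_contiguous {p q : ℕ} (hp : 0 < p) (h : p ≤ q) (σ : 𝕜) :
    σ * (p + 1) * kummer (p + 2) (q + 2) σ + (q - σ) * (q + 1) * kummer (p + 1) (q + 1) σ
      - q * (q + 1) * kummer p q σ = 0 := by
  have hq : 0 < q := hp.trans_le h
  have hp0 : (p : 𝕜) ≠ 0 := Nat.cast_ne_zero.2 hp.ne'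
  have hq0 : (q : 𝕜) ≠ 0 := Nat.cast_ne_zero.2 hq.ne'
  have hq1 : (q + 1 : 𝕜) ≠ 0 := Nat.cast_add_one_ne_zero q
  have hode := kummer_ode (𝕜 := 𝕜) hq h σ
  have e1 : derivCoeff (kummerCoeff p q) = fun n => (p / q : 𝕜) * kummerCoeff (p + 1) (q + 1) n :=
    funext fun n => derivCoeff_kummerCoeff hq p n
  have e2 : derivCoeff (derivCoeff (kummerCoeff p q)) =
      fun n => (p / q : 𝕜) * ((p + 1 : 𝕜) / (q + 1) * kummerCoeff (p + 2) (q + 2) n) := by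
    ext n
    have := derivCoeff_kummerCoeff (𝕜 := 𝕜) q.succ_pos (p + 1) n
    rw [e1]
    simp only [derivCoeff, Nat.succ_eq_add_one, Nat.cast_add, Nat.cast_one] at this ⊢
    rw [← this]
    ring
  have s1 : seriesSum (derivCoeff (kummerCoeff p q)) σ
      = p / q * kummer (p + 1) (q + 1) σ := by
    rw [e1, kummer_eq_seriesSum]
    simp only [seriesSum, mul_assoc, tsum_mul_left]
  have s2 : seriesSum (derivCoeff (derivCoeff (kummerCoeff p q))) σ
      = p / q * ((p + 1) / (q + 1) * kummer (p + 2) (q + 2) σ) := by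
    rw [e2, kummer_eq_seriesSum]
    simp only [seriesSum, mul_assoc, tsum_mul_left]
  rw [s1, s2] at hode
  field_simp at hode
  rw [mul_zero] at hode
  rcases mul_eq_zero.1 hode with h' | h'
  · exact absurd h' hp0
  · linear_combination h'

end Kummer

/-! ### Holonomicity of the moment generating function -/

section Mgf

variable {𝕜 : Type*} [RCLike 𝕜]

theorem isHolonomicFst_zfMgf {N NR : ℕ} (hNR : 0 < NR) (h : N ≤ NR) {Γ : 𝕜} (hΓ : Γ ≠ 0) :
    IsHolonomicFst (fun s a : 𝕜 => zfMgf N NR Γ s a) {q | 1 - Γ * q.1 ≠ 0} := by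
  let s : MvPolynomial (Fin 2) 𝕜 := .X 0
  let a : MvPolynomial (Fin 2) 𝕜 := .X 1
  let g : MvPolynomial (Fin 2) 𝕜 := .C Γ
  let n : MvPolynomial (Fin 2) 𝕜 := .C (N : 𝕜)
  let b : MvPolynomial (Fin 2) 𝕜 := .C (NR : 𝕜)
  let v : MvPolynomial (Fin 2) 𝕜 := 1 - g * s
  -- The coefficients are Kummer's equation pulled back along `a * Γs/(1 - Γs)`, conjugated by `(1 -
  -- Γs)^(-N)` and cleared of denominators. At `s = -1/Γ` the leading one is `-4/Γ`.
  refine ⟨2, fun i => match i with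
    | 0 => n * (n + 1) * g ^ 2 * s - n * g * b - n * a * g
    | 1 => -(2 * n + 2) * g * s * v + b * v - a * g * s
    | _ => s * v ^ 2, fun s₀ a₀ hv => ⟨⟨-Γ⁻¹, ?_⟩, ?_, ?_⟩⟩
  · simp only [s, v, g, map_mul, map_pow, map_sub, map_one, MvPolynomial.eval_X,
      MvPolynomial.eval_C, Matrix.cons_val_zero]
    rw [mul_neg, mul_inv_cancel₀ hΓ]
    norm_num [hΓ]
  · have hv : 1 - Γ * s₀ ≠ 0 := hv
    unfold zfMgf
    refine ContDiffAt.mul (contDiffAt_const.div (by fun_prop) (pow_ne_zero _ hv)) ?_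
    exact (contDiff_kummer h 2).contDiffAt.comp s₀
      (contDiffAt_const.mul (ContDiffAt.div (by fun_prop) (by fun_prop) hv))
  · set c : ℕ → 𝕜 := kummerCoeff N NR
    have hc : FactorialDecay c := factorialDecay_kummerCoeff h
    have hφ : ∀ x : 𝕜, 1 - Γ * x ≠ 0 →
        HasDerivAt (fun x => a₀ * (Γ * x / (1 - Γ * x))) (a₀ * Γ / (1 - Γ * x) ^ 2) x := by
      intro x hx
      have h1 : HasDerivAt (fun x : 𝕜 => Γ * x) Γ x := by
        simpa using (hasDerivAt_id x).const_mul Γ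
      refine ((h1.div (h1.const_sub 1) hx).const_mul a₀).congr_deriv ?_
      field_simp
      ring
    have hw : ∀ (k : ℕ) (x : 𝕜), 1 - Γ * x ≠ 0 →
        HasDerivAt (fun x => 1 / (1 - Γ * x) ^ k) (k * Γ / (1 - Γ * x) ^ (k + 1)) x := by
      intro k x hx
      have h1 : HasDerivAt (fun x : 𝕜 => Γ * x) Γ x := by
        simpa using (hasDerivAt_id x).const_mul Γ
      have := (hasDerivAt_const x (1 : 𝕜)).div ((h1.const_sub 1).pow k) (pow_ne_zero k hx)
      refine this.congr_deriv ?_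
      cases k with
      | zero => simp
      | succ k =>
        simp only [Pi.pow_apply, Nat.add_sub_cancel]
        field_simp
        ring
    -- Derivatives of products `(1 - Γx)^(-k) G(φ(x))` are combinations of such products, so this
    -- single formula serves for both derivatives.
    have hF : ∀ (k : ℕ) (d : ℕ → 𝕜), FactorialDecay d → ∀ x : 𝕜, 1 - Γ * x ≠ 0 →
        HasDerivAt (fun x => 1 / (1 - Γ * x) ^ k * seriesSum d (a₀ * (Γ * x / (1 - Γ * x))))
          (k * Γ * (1 / (1 - Γ * x) ^ (k + 1) * seriesSum d (a₀ * (Γ * x / (1 - Γ * x)))) +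
          a₀ * Γ * (1 / (1 - Γ * x) ^ (k + 2) *
            seriesSum (derivCoeff d) (a₀ * (Γ * x / (1 - Γ * x))))) x := by
      intro k d hd x hx
      refine ((hw k x hx).mul ((hd.hasDerivAt _).comp x (hφ x hx))).congr_deriv ?_
      simp only [Function.comp_apply]
      generalize 1 - Γ * x = V
      ring
    have hfun : (fun x => zfMgf N NR Γ x a₀) =
        fun x => 1 / (1 - Γ * x) ^ N * seriesSum c (a₀ * (Γ * x / (1 - Γ * x))) := by
      ext x; rw [zfMgf, kummer_eq_seriesSum]
    have hv' : 1 - Γ * s₀ ≠ 0 := hv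
    -- To be differentiated again, the formula for the first derivative is needed on a neighbourhood
    -- of `s₀`.
    have hev : ∀ᶠ x in nhds s₀, 1 - Γ * x ≠ 0 :=
      ContinuousAt.eventually_ne (by fun_prop) hv'
    have hd1 := (hF N c hc s₀ hv').deriv
    have hD := ((hF (N + 1) c hc s₀ hv').const_mul (N * Γ)).add
      ((hF (N + 2) _ hc.derivCoeff s₀ hv').const_mul (a₀ * Γ))
    have hd2 : iteratedDeriv 2 (fun x => zfMgf N NR Γ x a₀) s₀ = _ := Eq.trans (by
      rw [iteratedDeriv_succ, iteratedDeriv_one, hfun]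
      exact Filter.EventuallyEq.deriv_eq (hev.mono fun x hx => (hF N c hc x hx).deriv)) hD.deriv
    have hode := kummer_ode (𝕜 := 𝕜) hNR h (a₀ * (Γ * s₀ / (1 - Γ * s₀)))
    simp only [Finset.sum_range_succ, Finset.range_zero, Finset.sum_empty, zero_add]
    rw [hd2, iteratedDeriv_one, iteratedDeriv_zero, congrFun hfun s₀, hfun, hd1]
    clear hd1 hd2 hD hev
    rw [kummer_eq_seriesSum] at hode
    simp only [s, a, g, n, b, v, map_mul, map_pow, map_sub, map_add, map_neg, map_one,
      MvPolynomial.eval_X, MvPolynomial.eval_C, Matrix.cons_val_zero, Matrix.cons_val_one,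
      Nat.cast_add, Nat.cast_one, Nat.cast_ofNat, map_ofNat]
    change _ * seriesSum (derivCoeff (derivCoeff c)) _ + _ * seriesSum (derivCoeff c) _
      - _ * seriesSum c _ = 0 at hode
    generalize seriesSum (derivCoeff (derivCoeff c)) _ = F₂ at hode ⊢
    generalize seriesSum (derivCoeff c) _ = F₁ at hode ⊢
    generalize seriesSum c _ = F₀ at hode ⊢
    have hs₀ : s₀ = (1 - (1 - Γ * s₀)) / Γ := by field_simp; ring
    generalize hV : 1 - Γ * s₀ = V at hode hv' hs₀ ⊢
    simp only [one_div, pow_add, mul_inv, pow_one]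
    generalize (V ^ N)⁻¹ = W
    clear hv hV
    subst hs₀
    field_simp at hode ⊢
    linear_combination (a₀ * W * Γ) * hode

theorem isHolonomicFst_zfMgf_swap {N NR : ℕ} (hNR : 0 < NR) (h : N ≤ NR) (Γ : 𝕜) :
    IsHolonomicFst (fun a s : 𝕜 => zfMgf N NR Γ s a)
      (Prod.swap ⁻¹' {q : 𝕜 × 𝕜 | 1 - Γ * q.1 ≠ 0}) := by
  let a : MvPolynomial (Fin 2) 𝕜 := .X 0
  let s : MvPolynomial (Fin 2) 𝕜 := .X 1
  let g : MvPolynomial (Fin 2) 𝕜 := .C Γ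
  let n : MvPolynomial (Fin 2) 𝕜 := .C (N : 𝕜)
  let b : MvPolynomial (Fin 2) 𝕜 := .C (NR : 𝕜)
  refine ⟨2, fun i => match i with
    | 0 => -n * g * s
    | 1 => b * (1 - g * s) - a * g * s
    | _ => (1 - g * s) * a, fun a₀ s₀ hv => ?_⟩
  have hv : 1 - Γ * s₀ ≠ 0 := hv
  set u := Γ * s₀ / (1 - Γ * s₀) with hu
  -- For fixed `s₀` both the prefactor and the scale `u` are constants, absorbed into the
  -- coefficients.
  set c : ℕ → 𝕜 := fun n => 1 / (1 - Γ * s₀) ^ N * (kummerCoeff N NR n * u ^ n) with hcdef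
  have hc : FactorialDecay c := by
    refine ⟨‖1 / (1 - Γ * s₀) ^ N‖, ‖u‖, norm_nonneg _, fun n => ?_⟩
    rw [hcdef, norm_mul, ← kummerTerm_eq]
    gcongr
    exact norm_kummerTerm_le h n u
  have hfun : (fun x => zfMgf N NR Γ s₀ x) = seriesSum c := by
    ext x
    rw [zfMgf, kummer_eq_seriesSum, seriesSum, seriesSum, ← tsum_mul_left]
    exact tsum_congr fun n => by rw [mul_pow]; ring
  refine ⟨⟨1, ?_⟩, ?_, ?_⟩
  · simpa [s, a, g] using hv
  · rw [hfun]
    exact (hc.contDiff 2).contDiffAt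
  · have hode := seriesSum_kummer_ode (p := N) (q := NR) c u hc (fun n => by
      have := kummerCoeff_succ (𝕜 := 𝕜) hNR N n
      simp only [hcdef]
      linear_combination 1 / (1 - Γ * s₀) ^ N * u ^ (n + 1) * this) a₀
    rw [hfun]
    simp only [Finset.sum_range_succ, Finset.range_zero, Finset.sum_empty, zero_add,
      hc.iteratedDeriv, Function.iterate_succ_apply, Function.iterate_zero_apply]
    simp only [s, a, g, n, b, map_mul, map_sub, map_neg, map_one,
      MvPolynomial.eval_X, MvPolynomial.eval_C, Matrix.cons_val_zero, Matrix.cons_val_one]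
    have hu' : u * (1 - Γ * s₀) = Γ * s₀ := div_mul_cancel₀ _ hv
    linear_combination (1 - Γ * s₀) * hode
      + (a₀ * seriesSum (derivCoeff c) a₀ + N * seriesSum c a₀) * hu'

end Mgf

/-! ### The series for the density -/

section Pdf

variable {𝕜 : Type*} [RCLike 𝕜]

/-- The density at `t` of the gamma distribution with shape `N + k` and scale `Γ`. -/
noncomputable def erlangPdf (N : ℕ) (Γ t : 𝕜) (k : ℕ) : 𝕜 :=
  t ^ (N + k - 1) * NormedSpace.exp (-t / Γ) / (((N + k - 1).factorial : 𝕜) * Γ ^ (N + k))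

theorem erlangPdf_succ {N : ℕ} (hN : 0 < N) {Γ : 𝕜} (hΓ : Γ ≠ 0) (t : 𝕜) (k : ℕ) :
    (N + k) * erlangPdf N Γ t (k + 1) = t / Γ * erlangPdf N Γ t k := by
  obtain ⟨m, rfl⟩ := Nat.exists_eq_add_of_lt hN
  have h1 := natCast_factorial_ne_zero (𝕜 := 𝕜) (m + k)
  have h2 := natCast_add_natCast_ne_zero (𝕜 := 𝕜) (Nat.succ_pos m) k
  have e1 : 0 + m + 1 + (k + 1) - 1 = m + k + 1 := by lia
  have e2 : 0 + m + 1 + k - 1 = m + k := by lia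
  have h3 := Nat.cast_add_one_ne_zero (R := 𝕜) (m + k)
  rw [erlangPdf, erlangPdf, e1, e2, Nat.factorial_succ]
  push_cast at h3 ⊢
  field_simp
  ring

/-- A single term of the exponential series is at most its sum. The bound is uniform in `k`, so
`n`-th differences grow at most like `2 ^ n`. -/
theorem norm_erlangPdf_le (N : ℕ) (hN : 0 < N) (Γ t : 𝕜) (k : ℕ) :
    ‖erlangPdf N Γ t k‖ ≤ ‖NormedSpace.exp (-t / Γ)‖ / ‖Γ‖ * Real.exp (‖t‖ / ‖Γ‖) := by
  have e : N + k = N + k - 1 + 1 := by lia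
  have h := Real.pow_div_factorial_le_exp (x := ‖t‖ / ‖Γ‖) (by positivity) (N + k - 1)
  calc ‖erlangPdf N Γ t k‖
      = ‖NormedSpace.exp (-t / Γ)‖ / ‖Γ‖ *
        ((‖t‖ / ‖Γ‖) ^ (N + k - 1) / (N + k - 1).factorial) := by
        rw [erlangPdf]
        generalize hM : N + k - 1 = M at *
        rw [e, norm_div, norm_mul, norm_mul, norm_pow, norm_pow, RCLike.norm_natCast, pow_succ,
          div_pow]
        ring
    _ ≤ _ := by gcongr

/-- The inverse Laplace transform of `(1 - Γ s) ^ (-N) * (Γ s / (1 - Γ s)) ^ n`. -/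
noncomputable def erlangDiff (N : ℕ) (Γ t : 𝕜) (n : ℕ) : 𝕜 :=
  ∑ m ∈ Finset.range (n + 1), (n.choose m : 𝕜) * (-1) ^ m * erlangPdf N Γ t (n - m)

theorem zfPdf_eq_tsum (N NR : ℕ) (Γ t a : 𝕜) :
    zfPdf N NR Γ t a = ∑' n, kummerTerm N NR n a * erlangDiff N Γ t n := by
  refine tsum_congr fun n => ?_
  congr 1
  refine Finset.sum_congr rfl fun m hm => ?_
  have : N + (n - m) = N + n - m := by have := Finset.mem_range.1 hm; lia
  rw [erlangPdf, this]
  ring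

theorem erlangDiff_eq_fwdDiff (N : ℕ) (Γ t : 𝕜) (n : ℕ) :
    erlangDiff N Γ t n = (fwdDiff 1)^[n] (erlangPdf N Γ t) 0 := by
  rw [fwdDiff_iter_eq_sum_shift, erlangDiff, ← Finset.sum_range_reflect]
  refine Finset.sum_congr rfl fun m hm => ?_
  have hm : m ≤ n := by have := Finset.mem_range.1 hm; lia
  have e : n + 1 - 1 - m = n - m := by lia
  rw [e, Nat.choose_symm hm, Nat.sub_sub_self hm, zero_add, smul_eq_mul, mul_one, zsmul_eq_mul]
  push_cast
  ring

theorem fwdDiff_iter_succ_apply (x : ℕ → 𝕜) (n k : ℕ) :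
    (fwdDiff 1)^[n + 1] x k = (fwdDiff 1)^[n] x (k + 1) - (fwdDiff 1)^[n] x k := by
  rw [Function.iterate_succ_apply', fwdDiff]

/-- This is the discrete Leibniz rule: `hx` is differenced `n + 1` times, and the factor `N + k`,
being affine in `k`, contributes only two terms. -/
theorem fwdDiff_iter_recurrence {N τ : 𝕜} {x : ℕ → 𝕜}
    (hx : ∀ k : ℕ, (N + k) * x (k + 1) = τ * x k) (n k : ℕ) :
    (N + k + n + 1) * (fwdDiff 1)^[n + 1] x (k + 1) + (n + 1) * (fwdDiff 1)^[n] x (k + 1)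
      = τ * (fwdDiff 1)^[n + 1] x k := by
  induction n generalizing k with
  | zero =>
    have h0 := hx k
    have h1 := hx (k + 1)
    simp only [fwdDiff_iter_succ_apply, Function.iterate_zero_apply]
    push_cast at h1 ⊢
    linear_combination h1 - h0
  | succ n ih =>
    have h0 := ih k
    have h1 := ih (k + 1)
    rw [fwdDiff_iter_succ_apply x (n + 1) k, fwdDiff_iter_succ_apply x (n + 1) (k + 1)]
    rw [fwdDiff_iter_succ_apply x n (k + 1 + 1), fwdDiff_iter_succ_apply x n (k + 1)] at *
    push_cast at h1 ⊢
    linear_combination h1 - h0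

theorem erlangDiff_zero_recurrence {N : ℕ} (hN : 0 < N) {Γ : 𝕜} (hΓ : Γ ≠ 0) (t : 𝕜) :
    N * erlangDiff N Γ t 1 + (N - t / Γ) * erlangDiff N Γ t 0 = 0 := by
  have h := erlangPdf_succ hN hΓ t 0
  have e : erlangDiff N Γ t 1 = erlangPdf N Γ t 1 - erlangPdf N Γ t 0 := by
    simp [erlangDiff, Finset.sum_range_succ]; ring
  have e0 : erlangDiff N Γ t 0 = erlangPdf N Γ t 0 := by simp [erlangDiff]
  rw [e, e0]
  simp only [Nat.cast_zero, zero_add, add_zero] at h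
  linear_combination h

theorem erlangDiff_recurrence {N : ℕ} (hN : 0 < N) {Γ : 𝕜} (hΓ : Γ ≠ 0) (t : 𝕜) (n : ℕ) :
    (N + n + 1) * erlangDiff N Γ t (n + 2) + (N + 2 * (n + 1) - t / Γ) * erlangDiff N Γ t (n + 1)
      + (n + 1) * erlangDiff N Γ t n = 0 := by
  have h := fwdDiff_iter_recurrence (fun k => erlangPdf_succ hN hΓ t k) n 0
  have h1 := fwdDiff_iter_succ_apply (erlangPdf N Γ t) n 0
  have h2 := fwdDiff_iter_succ_apply (erlangPdf N Γ t) (n + 1) 0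
  simp only [erlangDiff_eq_fwdDiff]
  rw [zero_add] at h h1 h2
  push_cast at h
  linear_combination h + (N + n + 1) * h2 + (n + 1) * h1

theorem norm_erlangDiff_le {N : ℕ} {Γ t : 𝕜} {B : ℝ} (hB : ∀ k, ‖erlangPdf N Γ t k‖ ≤ B) (n : ℕ) :
    ‖erlangDiff N Γ t n‖ ≤ B * 2 ^ n := by
  refine (norm_sum_le _ _).trans ?_
  have : (∑ m ∈ Finset.range (n + 1), (n.choose m : ℝ) * B) = B * 2 ^ n := by
    rw [← Finset.sum_mul, mul_comm]
    congr 1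
    exact_mod_cast Nat.sum_range_choose n
  rw [← this]
  refine Finset.sum_le_sum fun m _ => ?_
  rw [norm_mul, norm_mul, norm_pow, norm_neg, norm_one, one_pow, mul_one, RCLike.norm_natCast]
  gcongr
  exact hB _

/-- The coefficients of the density as a power series in `a`. -/
noncomputable def pdfCoeff (N NR : ℕ) (Γ t : 𝕜) (n : ℕ) : 𝕜 :=
  kummerCoeff N NR n * erlangDiff N Γ t n

theorem zfPdf_eq_seriesSum (N NR : ℕ) (Γ t : 𝕜) :
    (fun a => zfPdf N NR Γ t a) = seriesSum (pdfCoeff N NR Γ t) := by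
  ext a
  rw [zfPdf_eq_tsum, seriesSum]
  exact tsum_congr fun n => by rw [kummerTerm_eq, pdfCoeff]; ring

theorem factorialDecay_pdfCoeff {N NR : ℕ} (hN : 0 < N) (h : N ≤ NR) (Γ t : 𝕜) :
    FactorialDecay (pdfCoeff N NR Γ t) := by
  refine ⟨‖NormedSpace.exp (-t / Γ)‖ / ‖Γ‖ * Real.exp (‖t‖ / ‖Γ‖), 2, by norm_num,
    fun n => ?_⟩
  rw [pdfCoeff, norm_mul]
  have h1 := norm_kummerCoeff_le (𝕜 := 𝕜) h n
  have h2 := norm_erlangDiff_le (norm_erlangPdf_le N hN Γ t) n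
  refine (mul_le_mul h1 h2 (norm_nonneg _) (by positivity)).trans_eq ?_
  ring

theorem isHolonomicFst_zfPdf_swap {N NR : ℕ} (hN : 0 < N) (h : N ≤ NR) {Γ : 𝕜} (hΓ : Γ ≠ 0) :
    IsHolonomicFst (fun a t : 𝕜 => zfPdf N NR Γ t a) Set.univ := by
  have hNR : 0 < NR := hN.trans_le h
  let a : MvPolynomial (Fin 2) 𝕜 := .X 0
  let t : MvPolynomial (Fin 2) 𝕜 := .X 1
  let g : MvPolynomial (Fin 2) 𝕜 := .C Γ⁻¹
  let n : MvPolynomial (Fin 2) 𝕜 := .C (N : 𝕜)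
  let b : MvPolynomial (Fin 2) 𝕜 := .C (NR : 𝕜)
  -- Multiplying `erlangDiff_recurrence` by `(NR + n) * kummerCoeff N NR (n + 1)` and applying
  -- `kummerCoeff_succ` twice gives a recurrence for `pdfCoeff` whose coefficients are polynomials
  -- in `n` of degree at most 3; this equation encodes it.
  refine ⟨3, fun i => match i with
    | 0 => (n - t * g) * (b - 1) + n * a
    | 1 => b * (b - 1) + (n - t * g + 2 * b) * a + a ^ 2
    | 2 => 2 * b * a + 2 * a ^ 2
    | _ => a ^ 2, fun a₀ t₀ _ => ?_⟩
  set c := pdfCoeff N NR Γ t₀ with hcdef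
  have hc : FactorialDecay c := factorialDecay_pdfCoeff hN h Γ t₀
  refine ⟨⟨1, by simp [a]⟩, ?_, ?_⟩
  · rw [zfPdf_eq_seriesSum]
    exact (hc.contDiff 3).contDiffAt
  · rw [zfPdf_eq_seriesSum]
    simp only [Finset.sum_range_succ, Finset.range_zero, Finset.sum_empty, zero_add,
      ← hcdef, hc.iteratedDeriv, Function.iterate_succ_apply, Function.iterate_zero_apply]
    simp only [a, t, g, n, b, map_mul, map_sub, map_add, map_one, map_pow, map_ofNat,
      MvPolynomial.eval_X, MvPolynomial.eval_C, Matrix.cons_val_zero, Matrix.cons_val_one]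
    have hc1 := hc.derivCoeff
    have hc2 := hc1.derivCoeff
    have s0 := hc.hasSum a₀
    have s1 := hc1.hasSum a₀
    have s01 := hc.hasSum_natCast_mul a₀
    have s12 := hc1.hasSum_natCast_mul a₀
    have s23 := FactorialDecay.hasSum_shiftCoeff (hc2.hasSum_natCast_mul a₀)
    have s13 := FactorialDecay.hasSum_shiftCoeff s12
    have s00 := FactorialDecay.hasSum_shiftCoeff s0
    have s02 := FactorialDecay.hasSum_shiftCoeff s01
    have hsum := ((((((s23.add (s12.mul_left (2 * NR : 𝕜))).add
      (s1.mul_left (NR * (NR - 1) : 𝕜))).add (s13.mul_left 2)).add (s01.mul_left (N - t₀ * Γ⁻¹ + 2 * NR))).add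
      (s0.mul_left ((N - t₀ * Γ⁻¹) * (NR - 1)))).add s02).add (s00.mul_left (N : 𝕜))
    have h0 := hsum.unique (hasSum_zero.congr_fun fun n => ?_)
    · linear_combination h0
    · cases n with
      -- The boundary case: the general recurrence at index `-1`, where `NR + n` becomes `NR - 1`
      -- and the last term is absent.
      | zero =>
        have e0 := erlangDiff_zero_recurrence hN hΓ t₀
        have k0 := kummerCoeff_succ (𝕜 := 𝕜) hNR N 0
        simp only [shiftCoeff, derivCoeff, hcdef, pdfCoeff]
        simp only [Nat.cast_zero, zero_add, add_zero, one_mul] at k0 ⊢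
        linear_combination (NR - 1 : 𝕜) * erlangDiff N Γ t₀ 1 * k0 +
          (NR - 1 : 𝕜) * kummerCoeff N NR 0 * e0
      | succ n =>
        have e0 := erlangDiff_recurrence hN hΓ t₀ n
        have k0 := kummerCoeff_succ (𝕜 := 𝕜) hNR N n
        have k1 := kummerCoeff_succ (𝕜 := 𝕜) hNR N (n + 1)
        simp only [shiftCoeff, derivCoeff, hcdef, pdfCoeff]
        push_cast at k1 ⊢
        linear_combination a₀ ^ (n + 1) * ((NR + n : 𝕜) * erlangDiff N Γ t₀ (n + 2) * k1
          + (NR + n : 𝕜) * kummerCoeff N NR (n + 1) * e0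
          - erlangDiff N Γ t₀ n * k0)

end Pdf

/-! ### The density as a function of time -/

section PdfInTime

variable {𝕜 : Type*} [RCLike 𝕜]

/-- Splitting `(p)_(i+j) = (p)_j (p+j)_i` separates the summation indices, so that the sum over `i`
becomes a confluent hypergeometric value at `-a`. -/
theorem kummerTerm_add (p q i j : ℕ) (a : 𝕜) :
    kummerTerm p q (i + j) a * ((i + j).choose i * (-1) ^ i)
      = kummerTerm p q j a * kummerTerm (p + j) (q + j) i (-a) := by
  have e1 : (p.ascFactorial (i + j) : 𝕜) = p.ascFactorial j * (p + j).ascFactorial i := by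
    rw [add_comm i j]; exact_mod_cast (Nat.ascFactorial_mul_ascFactorial p j i).symm
  have e2 : (q.ascFactorial (i + j) : 𝕜) = q.ascFactorial j * (q + j).ascFactorial i := by
    rw [add_comm i j]; exact_mod_cast (Nat.ascFactorial_mul_ascFactorial q j i).symm
  have e3 : ((i + j).choose i : 𝕜) * i.factorial * j.factorial = (i + j).factorial := by
    have := Nat.add_choose_mul_factorial_mul_factorial i j
    rw [← Nat.choose_symm_add] at this
    exact_mod_cast this
  have h1 := natCast_factorial_ne_zero (𝕜 := 𝕜) i
  have h2 := natCast_factorial_ne_zero (𝕜 := 𝕜) j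
  have h3 := natCast_factorial_ne_zero (𝕜 := 𝕜) (i + j)
  have e4 : ((i + j).choose i : 𝕜) / (i + j).factorial = 1 / i.factorial / j.factorial := by
    field_simp
    linear_combination e3
  simp only [kummerTerm, e1, e2]
  rw [show (-a) ^ i = (-1) ^ i * a ^ i by rw [← mul_pow]; ring, pow_add]
  simp only [div_eq_mul_inv, mul_inv] at e4 ⊢
  linear_combination (p.ascFactorial j * (p + j).ascFactorial i * (q.ascFactorial j : 𝕜)⁻¹ *
    ((q + j).ascFactorial i : 𝕜)⁻¹ * a ^ i * a ^ j * (-1) ^ i) * e4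

theorem zfPdf_eq_tsum_kummer {N NR : ℕ} (hN : 0 < N) (h : N ≤ NR) (Γ t a : 𝕜) :
    zfPdf N NR Γ t a =
      ∑' k, erlangPdf N Γ t k * (kummerTerm N NR k a * kummer (N + k) (NR + k) (-a)) := by
  let f : ℕ × ℕ → 𝕜 := fun ij =>
    erlangPdf N Γ t ij.2 * (kummerTerm N NR ij.2 a * kummerTerm (N + ij.2) (NR + ij.2) ij.1 (-a))
  have hf : Summable f := by
    set B := ‖NormedSpace.exp (-t / Γ)‖ / ‖Γ‖ * Real.exp (‖t‖ / ‖Γ‖)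
    have hs := Real.summable_pow_div_factorial ‖a‖
    have hb := ((hs.mul_of_nonneg hs (fun _ => by positivity) fun _ => by positivity).mul_left B)
    refine Summable.of_norm_bounded hb fun ij => ?_
    rw [norm_mul, norm_mul]
    have h1 := norm_kummerTerm_le (𝕜 := 𝕜) h ij.2 a
    have h2 := norm_kummerTerm_le (𝕜 := 𝕜) (Nat.add_le_add_right h ij.2) ij.1 (-a)
    rw [norm_neg] at h2
    have h3 := norm_erlangPdf_le N hN Γ t ij.2
    rw [mul_comm (‖a‖ ^ ij.1 / _)]
    gcongr
  have hterm : ∀ n, kummerTerm N NR n a * erlangDiff N Γ t n =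
      ∑ ij ∈ Finset.HasAntidiagonal.antidiagonal n, f ij := by
    intro n
    rw [erlangDiff, ← Finset.Nat.sum_antidiagonal_eq_sum_range_succ
      (fun i j => (n.choose i : 𝕜) * (-1) ^ i * erlangPdf N Γ t j), Finset.mul_sum]
    refine Finset.sum_congr rfl fun ij hij => ?_
    rw [← Finset.HasAntidiagonal.mem_antidiagonal.1 hij]
    linear_combination erlangPdf N Γ t ij.2 * kummerTerm_add N NR ij.1 ij.2 a
  rw [zfPdf_eq_tsum, tsum_congr hterm]
  -- Absolute convergence lets the sum along antidiagonals be replaced by an iterated sum with `k`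
  -- outside.
  have hσ := Finset.HasAntidiagonal.sigmaAntidiagonalEquivProd (A := ℕ) |>.summable_iff.2 hf
  have e1 : ∑' ij, f ij = ∑' n, ∑ ij ∈ Finset.HasAntidiagonal.antidiagonal n, f ij := by
    rw [← Finset.HasAntidiagonal.sigmaAntidiagonalEquivProd.tsum_eq f]
    refine hσ.tsum_sigma.trans ?_
    refine tsum_congr fun n => ?_
    rw [← Finset.tsum_subtype]
    rfl
  rw [← e1, ← (Equiv.prodComm ℕ ℕ).tsum_eq f]
  refine (Summable.tsum_prod ((Equiv.prodComm ℕ ℕ).summable_iff.2 hf)).trans ?_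
  refine tsum_congr fun k => ?_
  simp only [f, Function.comp_apply, Equiv.prodComm_apply, Prod.fst_swap, Prod.snd_swap, tsum_mul_left, kummer]

/-- The coefficients of the density, divided by `t ^ (N - 1) * exp (-t / Γ)`, as a power series
in `t`. -/
noncomputable def timeCoeff (N NR : ℕ) (Γ a : 𝕜) (k : ℕ) : 𝕜 :=
  (a / Γ) ^ k / (NR.ascFactorial k * k.factorial) * kummer (N + k) (NR + k) (-a)
    / ((N - 1).factorial * Γ ^ N)

/-- The factor `(N)_k` of `kummerTerm` cancels against `(N + k - 1)! = (N - 1)! (N)_k` in the gamma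
density. -/
theorem zfPdf_eq_mul_seriesSum {N NR : ℕ} (hN : 0 < N) (h : N ≤ NR) (Γ t a : 𝕜) :
    zfPdf N NR Γ t a =
      t ^ (N - 1) * NormedSpace.exp (-t / Γ) * seriesSum (timeCoeff N NR Γ a) t := by
  rw [zfPdf_eq_tsum_kummer hN h, seriesSum, ← tsum_mul_left]
  refine tsum_congr fun k => ?_
  have e := Nat.factorial_mul_ascFactorial' N k hN
  have e' : ((N + k - 1).factorial : 𝕜) = (N - 1).factorial * N.ascFactorial k := by
    exact_mod_cast e.symm
  have h1 := natCast_ascFactorial_ne_zero (𝕜 := 𝕜) hN k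
  have e2 : N + k - 1 = N - 1 + k := by lia
  rw [e2] at e'
  simp only [timeCoeff, erlangPdf, kummerTerm, e', e2, pow_add, div_pow]
  generalize kummer (N + k) (NR + k) (-a) = K
  generalize (N.ascFactorial k : 𝕜) = A at h1
  generalize NormedSpace.exp (-t / Γ) = E
  simp only [div_eq_mul_inv, mul_inv]
  linear_combination (t ^ (N - 1) * t ^ k * E * ((N - 1).factorial : 𝕜)⁻¹ * (Γ ^ N)⁻¹ * (Γ ^ k)⁻¹ *
    (NR.ascFactorial k : 𝕜)⁻¹ * a ^ k * (k.factorial : 𝕜)⁻¹ * K) * mul_inv_cancel₀ h1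

theorem factorialDecay_timeCoeff {N NR : ℕ} (hN : 0 < N) (h : N ≤ NR) (Γ a : 𝕜) :
    FactorialDecay (timeCoeff N NR Γ a) := by
  have hNR : 0 < NR := hN.trans_le h
  refine ⟨Real.exp ‖a‖ / ‖((N - 1).factorial * Γ ^ N : 𝕜)‖, ‖a / Γ‖, norm_nonneg _, fun k => ?_⟩
  have h1 := norm_kummer_le (𝕜 := 𝕜) (Nat.add_le_add_right h k) (-a)
  rw [norm_neg] at h1
  have h2 : (1 : ℝ) ≤ NR.ascFactorial k := by
    exact_mod_cast Nat.ascFactorial_pos_of_pos hNR k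
  rw [timeCoeff, norm_div, norm_mul, norm_div, norm_pow, norm_mul, RCLike.norm_natCast,
    RCLike.norm_natCast]
  calc _ ≤ ‖a / Γ‖ ^ k / (1 * k.factorial) * Real.exp ‖a‖ /
        ‖((N - 1).factorial * Γ ^ N : 𝕜)‖ := by gcongr
    _ = _ := by ring

/-- This is `kummer_contiguous` with parameters `N + k`, `NR + k` at `σ = -a`, up to normalisation.
-/
theorem timeCoeff_recurrence {N NR : ℕ} (hN : 0 < N) (h : N ≤ NR) (Γ a : 𝕜) (k : ℕ) :
    (N + k + 1) * ((k + 2) * ((k + 1) * timeCoeff N NR Γ a (k + 2)))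
      - Γ⁻¹ * (NR + k + a) * ((k + 1) * timeCoeff N NR Γ a (k + 1))
      + a * Γ⁻¹ ^ 2 * timeCoeff N NR Γ a k = 0 := by
  have hNR : 0 < NR := hN.trans_le h
  have hK := kummer_contiguous (𝕜 := 𝕜) (p := N + k) (q := NR + k) (by lia) (by lia) (-a)
  have h1 := natCast_ascFactorial_ne_zero (𝕜 := 𝕜) hNR k
  have h2 := natCast_factorial_ne_zero (𝕜 := 𝕜) k
  have h3 := natCast_add_natCast_ne_zero (𝕜 := 𝕜) hNR k
  have h4 := natCast_add_natCast_ne_zero (𝕜 := 𝕜) hNR (k + 1)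
  have h5 := Nat.cast_add_one_ne_zero (R := 𝕜) k
  have h6 := Nat.cast_add_one_ne_zero (R := 𝕜) (k + 1)
  simp only [timeCoeff, Nat.ascFactorial_succ, Nat.factorial_succ, ← add_assoc]
  push_cast at *
  generalize kummer (N + k) (NR + k) (-a) = K₀ at *
  generalize kummer (N + k + 1) (NR + k + 1) (-a) = K₁ at *
  generalize kummer (N + k + 2) (NR + k + 2) (-a) = K₂ at *
  rw [← add_assoc] at h4
  simp only [div_eq_mul_inv, mul_pow, pow_succ, mul_inv]
  generalize ((N - 1).factorial : 𝕜)⁻¹ = P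
  generalize Γ⁻¹ = G
  generalize (Γ ^ N)⁻¹ = Q
  have h6' : (k + 2 : 𝕜) ≠ 0 := by
    convert h6 using 1; ring
  field_simp
  linear_combination (-a * a ^ k * G ^ 2 * G ^ k * P * Q * (k + 2)) * hK

theorem seriesSum_timeCoeff_ode {N NR : ℕ} (hN : 0 < N) (h : N ≤ NR) (Γ a t : 𝕜) :
    t * seriesSum (derivCoeff^[3] (timeCoeff N NR Γ a)) t
      + (N + 1 - Γ⁻¹ * t) * seriesSum (derivCoeff^[2] (timeCoeff N NR Γ a)) t
      - (NR + a) * Γ⁻¹ * seriesSum (derivCoeff (timeCoeff N NR Γ a)) t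
      + a * Γ⁻¹ ^ 2 * seriesSum (timeCoeff N NR Γ a) t = 0 := by
  have hc := factorialDecay_timeCoeff hN h Γ a
  have hrec := timeCoeff_recurrence hN h Γ a
  simp only [Function.iterate_succ_apply, Function.iterate_zero_apply]
  set c := timeCoeff N NR Γ a
  have hc1 := hc.derivCoeff
  have hc2 := hc1.derivCoeff
  have hsum := ((((hc2.hasSum_natCast_mul t).add ((hc2.hasSum t).mul_left (N + 1 : 𝕜))).sub
    ((hc1.hasSum_natCast_mul t).mul_left Γ⁻¹)).sub ((hc1.hasSum t).mul_left ((NR + a) * Γ⁻¹))).add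
    ((hc.hasSum t).mul_left (a * Γ⁻¹ ^ 2))
  have h0 := hsum.unique (hasSum_zero.congr_fun fun n => ?_)
  · linear_combination h0
  · simp only [derivCoeff]
    push_cast
    linear_combination t ^ n * hrec n

theorem contDiff_normedSpaceExp (n : ℕ) : ContDiff 𝕜 n (NormedSpace.exp : 𝕜 → 𝕜) := by
  induction n with
  | zero => exact contDiff_zero.2 NormedSpace.exp_continuous
  | succ n ih =>
    push_cast
    rw [contDiff_succ_iff_deriv]
    refine ⟨fun x => hasDerivAt_exp.differentiableAt, by simp, ?_⟩
    rwa [show deriv (NormedSpace.exp : 𝕜 → 𝕜) = NormedSpace.exp from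
      funext fun x => hasDerivAt_exp.deriv]

theorem hasDerivAt_pow_mul_exp_mul (m : ℕ) (Γ : 𝕜) {t g' : 𝕜} (ht : t ≠ 0) {g : 𝕜 → 𝕜}
    (hg : HasDerivAt g g' t) :
    HasDerivAt (fun t => t ^ m * NormedSpace.exp (-t / Γ) * g t)
      (t ^ m * NormedSpace.exp (-t / Γ) * (g' + (m / t - Γ⁻¹) * g t)) t := by
  have h1 : HasDerivAt (fun t : 𝕜 => -t / Γ) (-1 / Γ) t := (hasDerivAt_neg t).div_const Γ
  have h2 := (hasDerivAt_exp (𝕂 := 𝕜) (x := -t / Γ)).comp t h1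
  refine (((hasDerivAt_pow m t).mul h2).mul hg).congr_deriv ?_
  cases m with
  | zero => simp; ring
  | succ m =>
    simp only [Function.comp_apply, Nat.add_sub_cancel, Pi.mul_apply]
    field_simp
    ring

theorem isHolonomicFst_zfPdf {N NR : ℕ} (hN : 0 < N) (h : N ≤ NR) (Γ : 𝕜) :
    IsHolonomicFst (fun t a : 𝕜 => zfPdf N NR Γ t a) Set.univ := by
  let t : MvPolynomial (Fin 2) 𝕜 := .X 0
  let a : MvPolynomial (Fin 2) 𝕜 := .X 1
  let g : MvPolynomial (Fin 2) 𝕜 := .C Γ⁻¹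
  let n : MvPolynomial (Fin 2) 𝕜 := .C (N : 𝕜)
  let b : MvPolynomial (Fin 2) 𝕜 := .C (NR : 𝕜)
  let m : MvPolynomial (Fin 2) 𝕜 := .C ((N - 1 : ℕ) : 𝕜)
  let w : MvPolynomial (Fin 2) 𝕜 := m - g * t
  let v : MvPolynomial (Fin 2) 𝕜 := n + 1 - g * t
  -- Obtained from `seriesSum_timeCoeff_ode` by conjugating with `t^(N-1) exp(-t/Γ)`, whose
  -- logarithmic derivative is `w / t`, and multiplying by `t ^ 3`.
  refine ⟨3, fun i => match i with
    | 0 => t * (-w ^ 3 - 3 * w * m - 2 * m) + t * v * (w ^ 2 + m) + t ^ 2 * (b + a) * g * w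
        + t ^ 3 * a * g ^ 2
    | 1 => 3 * t ^ 2 * (w ^ 2 + m) - 2 * t ^ 2 * v * w - t ^ 3 * (b + a) * g
    | 2 => t ^ 3 * (v - 3 * w)
    | _ => t ^ 4, fun t₀ a₀ _ => ?_⟩
  set c := timeCoeff N NR Γ a₀ with hcdef
  have hc : FactorialDecay c := factorialDecay_timeCoeff hN h Γ a₀
  have hfun : (fun t => zfPdf N NR Γ t a₀) =
      fun t => t ^ (N - 1) * NormedSpace.exp (-t / Γ) * seriesSum c t :=
    funext fun t => zfPdf_eq_mul_seriesSum hN h Γ t a₀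
  refine ⟨⟨1, by simp [t]⟩, ?_, ?_⟩
  · rw [hfun]
    have he := (contDiff_normedSpaceExp (𝕜 := 𝕜) 3).comp (f := fun t : 𝕜 => -t / Γ) (by fun_prop)
    exact (((contDiff_id.pow (N - 1)).mul he).mul (hc.contDiff 3)).contDiffAt
  simp only [Finset.sum_range_succ, Finset.range_zero, Finset.sum_empty, zero_add]
  simp only [t, a, g, n, b, m, w, v, map_mul, map_sub, map_add, map_one, map_pow, map_ofNat,
    map_neg, MvPolynomial.eval_X, MvPolynomial.eval_C, Matrix.cons_val_zero, Matrix.cons_val_one]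
  -- All four coefficients are divisible by `t`, so the equation is trivial at `0`; elsewhere
  -- division by `t` is allowed.
  rcases eq_or_ne t₀ 0 with rfl | ht
  · simp
  have hode := seriesSum_timeCoeff_ode hN h Γ a₀ t₀
  simp only [Function.iterate_succ_apply, Function.iterate_zero_apply, ← hcdef] at hode
  have hu : ∀ x : 𝕜, x ≠ 0 → HasDerivAt (fun x : 𝕜 => ((N - 1 : ℕ) : 𝕜) / x - Γ⁻¹)
      (-((N - 1 : ℕ) : 𝕜) / x ^ 2) x := fun x hx => by
    refine (((hasDerivAt_const x ((N - 1 : ℕ) : 𝕜)).div (hasDerivAt_id x) hx).sub_const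
      Γ⁻¹).congr_deriv ?_
    simp
  have hu' : ∀ x : 𝕜, x ≠ 0 → HasDerivAt (fun x : 𝕜 => -((N - 1 : ℕ) : 𝕜) / x ^ 2)
      (2 * ((N - 1 : ℕ) : 𝕜) / x ^ 3) x := fun x hx => by
    refine (((hasDerivAt_const x (-((N - 1 : ℕ) : 𝕜))).div (hasDerivAt_pow 2 x)
      (pow_ne_zero 2 hx))).congr_deriv ?_
    field_simp
    simp
    ring
  have hG0 := hc.hasDerivAt
  have hG1 := hc.derivCoeff.hasDerivAt
  have hG2 := hc.derivCoeff.derivCoeff.hasDerivAt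
  have hf1 := fun x (hx : x ≠ 0) => hasDerivAt_pow_mul_exp_mul (N - 1) Γ hx (hG0 x)
  have hf2 := fun x (hx : x ≠ 0) => hasDerivAt_pow_mul_exp_mul (N - 1) Γ hx
    ((hG1 x).add ((hu x hx).mul (hG0 x)))
  have hf3 := hasDerivAt_pow_mul_exp_mul (N - 1) Γ ht
    (((hG2 t₀).add (((hu' t₀ ht).mul (hG0 t₀)).add ((hu t₀ ht).mul (hG1 t₀)))).add
      ((hu t₀ ht).mul ((hG1 t₀).add ((hu t₀ ht).mul (hG0 t₀)))))
  have hne : ∀ x : 𝕜, x ≠ 0 → ∀ᶠ y in nhds x, y ≠ 0 := fun x hx => continuousAt_id.eventually_ne hx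
  have hd1 : ∀ x : 𝕜, x ≠ 0 → iteratedDeriv 1 (fun t => zfPdf N NR Γ t a₀) x = _ := fun x hx =>
    Eq.trans (by rw [iteratedDeriv_one, hfun]) (hf1 x hx).deriv
  have hd2 : ∀ x : 𝕜, x ≠ 0 → iteratedDeriv 2 (fun t => zfPdf N NR Γ t a₀) x = _ := fun x hx =>
    Eq.trans (by
      rw [iteratedDeriv_succ]
      exact Filter.EventuallyEq.deriv_eq ((hne x hx).mono hd1)) (hf2 x hx).deriv
  have hd3 : iteratedDeriv 3 (fun t => zfPdf N NR Γ t a₀) t₀ = _ :=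
    Eq.trans (by
      rw [iteratedDeriv_succ]
      exact Filter.EventuallyEq.deriv_eq ((hne t₀ ht).mono hd2)) hf3.deriv
  rw [hd1 t₀ ht, hd2 t₀ ht, hd3, iteratedDeriv_zero, congrFun hfun t₀]
  simp only [Pi.add_apply, Pi.mul_apply]
  clear hd1 hd2 hd3 hf1 hf2 hf3 hu hu' hG0 hG1 hG2 hne hfun hc
  generalize ((N - 1 : ℕ) : 𝕜) = M
  generalize seriesSum (derivCoeff (derivCoeff (derivCoeff c))) t₀ = G₃ at *
  generalize seriesSum (derivCoeff (derivCoeff c)) t₀ = G₂ at *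
  generalize seriesSum (derivCoeff c) t₀ = G₁ at *
  generalize seriesSum c t₀ = G₀ at *
  generalize t₀ ^ (N - 1) * NormedSpace.exp (-t₀ / Γ) = E
  generalize Γ⁻¹ = κ at *
  field_simp
  linear_combination (t₀ ^ 3 * E) * hode

end PdfInTime

/-! ### Nonnegativity of the density -/

section Nonneg

theorem kummer_self_eq_exp {p : ℕ} (hp : 0 < p) (σ : ℝ) : kummer p p σ = Real.exp σ := by
  rw [Real.exp_eq_exp_ℝ, NormedSpace.exp_eq_tsum_div, kummer]
  refine tsum_congr fun n => ?_
  rw [kummerTerm, div_self (natCast_ascFactorial_ne_zero hp n), one_mul]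

theorem kummer_apply_zero (p q : ℕ) : kummer p q (0 : ℝ) = 1 := by
  rw [kummer, tsum_eq_single 0]
  · simp [kummerTerm]
  · intro n hn
    simp [kummerTerm, hn]

/-- The operator `q + σ d/dσ` multiplies the `n`-th coefficient by `q + n`, and `(q + n) / (q+1)_n =
q / (q)_n`. -/
theorem natCast_mul_kummer_eq {p q : ℕ} (hq : 0 < q) (h : p ≤ q) (σ : ℝ) :
    q * kummer p q σ = q * kummer p (q + 1) σ +
      σ * seriesSum (derivCoeff (kummerCoeff p (q + 1))) σ := by
  have hc := factorialDecay_kummerCoeff (𝕜 := ℝ) (h.trans q.le_succ)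
  have hsum := ((hc.hasSum σ).mul_left (q : ℝ)).add (hc.hasSum_natCast_mul σ)
  rw [kummer_eq_seriesSum, kummer_eq_seriesSum]
  refine (((factorialDecay_kummerCoeff (𝕜 := ℝ) h).hasSum σ).mul_left (q : ℝ)).unique
    (hsum.congr_fun fun n => ?_)
  have e2 : (q * (q + 1).ascFactorial n : ℝ) = (q + n) * q.ascFactorial n := by
    exact_mod_cast Nat.succ_ascFactorial q n
  have h1 := natCast_ascFactorial_ne_zero (𝕜 := ℝ) hq n
  have h2 := natCast_ascFactorial_ne_zero (𝕜 := ℝ) q.succ_pos n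
  simp only [kummerCoeff, Nat.succ_eq_add_one] at h2 ⊢
  field_simp
  linear_combination (p.ascFactorial n * σ ^ n) * e2

/-- Induction on `q` from `₁F₁(p; p; -y) = exp(-y)`. The derivative of `x^q ₁F₁(p; q+1; -x)` is `q
x^(q-1) ₁F₁(p; q; -x)`, so this product increases from its value `0` at `x = 0`. -/
theorem kummer_neg_nonneg {p q : ℕ} (hp : 0 < p) (h : p ≤ q) {y : ℝ} (hy : 0 ≤ y) :
    0 ≤ kummer p q (-y) := by
  induction q, h using Nat.le_induction generalizing y with
  | base => rw [kummer_self_eq_exp hp]; positivity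
  | succ q h ih =>
    have hq : 0 < q := hp.trans_le h
    rcases hy.eq_or_lt with rfl | hy
    · rw [neg_zero, kummer_apply_zero]; exact zero_le_one
    have hc := factorialDecay_kummerCoeff (𝕜 := ℝ) (h.trans q.le_succ)
    have hd : ∀ x : ℝ, HasDerivAt (fun x => x ^ q * kummer p (q + 1) (-x))
        (x ^ (q - 1) * (q * kummer p q (-x))) x := by
      intro x
      have h1 := (hc.hasDerivAt (-x)).comp x (hasDerivAt_neg x)
      rw [← kummer_eq_seriesSum] at h1
      refine ((hasDerivAt_pow q x).mul h1).congr_deriv ?_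
      rw [natCast_mul_kummer_eq hq h]
      obtain ⟨q, rfl⟩ := Nat.exists_eq_succ_of_ne_zero hq.ne'
      simp only [Function.comp_apply, Nat.succ_eq_add_one, Nat.add_sub_cancel]
      ring
    have hmono : MonotoneOn (fun x => x ^ q * kummer p (q + 1) (-x)) (Set.Ici (0 : ℝ)) := by
      refine monotoneOn_of_deriv_nonneg (convex_Ici 0)
        (fun x _ => (hd x).continuousAt.continuousWithinAt)
        (fun x _ => (hd x).differentiableAt.differentiableWithinAt) fun x hx => ?_
      rw [interior_Ici] at hx
      rw [(hd x).deriv]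
      have := ih (le_of_lt hx)
      have hx : 0 < x := hx
      positivity
    have := hmono Set.self_mem_Ici hy.le hy.le
    simp only [zero_pow hq.ne', zero_mul] at this
    exact nonneg_of_mul_nonneg_right this (pow_pos hy q)

theorem erlangPdf_nonneg (N : ℕ) {Γ t : ℝ} (hΓ : 0 < Γ) (ht : 0 ≤ t) (k : ℕ) :
    0 ≤ erlangPdf N Γ t k := by
  rw [erlangPdf, ← Real.exp_eq_exp_ℝ]
  positivity

theorem zfPdf_nonneg {N NR : ℕ} (hN : 0 < N) (h : N ≤ NR) {Γ a t : ℝ} (hΓ : 0 < Γ) (ha : 0 ≤ a)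
    (ht : 0 ≤ t) : 0 ≤ zfPdf N NR Γ t a := by
  rw [zfPdf_eq_tsum_kummer hN h]
  refine tsum_nonneg fun k => mul_nonneg (erlangPdf_nonneg N hΓ ht k) (mul_nonneg ?_
    (kummer_neg_nonneg (by lia) (by lia) ha))
  rw [kummerTerm]
  positivity

end Nonneg

/-! ### The moment generating function of the density -/

section Laplace

theorem integral_exp_mul_erlangPdf {N : ℕ} (hN : 0 < N) {Γ s : ℝ} (hΓ : 0 < Γ)
    (hs : 0 < 1 - Γ * s) (k : ℕ) :
    ∫ t in Set.Ioi 0, Real.exp (s * t) * erlangPdf N Γ t k = (1 / (1 - Γ * s)) ^ (N + k) := by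
  have hr : 0 < (1 - Γ * s) / Γ := div_pos hs hΓ
  obtain ⟨M, hM⟩ : ∃ M, N + k = M + 1 := ⟨N + k - 1, by lia⟩
  have h := Real.integral_rpow_mul_exp_neg_mul_Ioi (a := (M + 1 : ℝ)) (by positivity) hr
  rw [Real.Gamma_nat_eq_factorial] at h
  have e : ∀ t ∈ Set.Ioi (0 : ℝ), Real.exp (s * t) * erlangPdf N Γ t k =
      (1 / (M.factorial * Γ ^ (M + 1))) *
        (t ^ ((M + 1 : ℝ) - 1) * Real.exp (-((1 - Γ * s) / Γ * t))) := by
    intro t _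
    rw [erlangPdf, hM, Nat.add_sub_cancel, add_sub_cancel_right, Real.rpow_natCast,
      ← Real.exp_eq_exp_ℝ]
    have : Real.exp (-((1 - Γ * s) / Γ * t)) = Real.exp (s * t) * Real.exp (-t / Γ) := by
      rw [← Real.exp_add]
      congr 1
      field_simp
      ring
    rw [this]
    ring
  rw [setIntegral_congr_fun measurableSet_Ioi e, integral_const_mul, h, hM]
  have h1 : (1 / ((1 - Γ * s) / Γ)) ^ (M + 1 : ℝ) = (1 / ((1 - Γ * s) / Γ)) ^ (M + 1) := by
    exact_mod_cast Real.rpow_natCast _ (M + 1)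
  rw [h1]
  have := natCast_factorial_ne_zero (𝕜 := ℝ) M
  rw [one_div_div, div_pow, one_div_pow]
  field_simp

theorem integrableOn_exp_mul_erlangPdf {N : ℕ} (hN : 0 < N) {Γ s : ℝ} (hΓ : 0 < Γ)
    (hs : 0 < 1 - Γ * s) (k : ℕ) :
    IntegrableOn (fun t => Real.exp (s * t) * erlangPdf N Γ t k) (Set.Ioi 0) := by
  -- The Bochner integral of a non-integrable function is `0` by convention, whereas this one is
  -- positive.
  by_contra hcon
  have h := integral_exp_mul_erlangPdf hN hΓ hs k
  rw [integral_undef hcon] at h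
  have : 0 < (1 / (1 - Γ * s)) ^ (N + k) := by positivity
  exact this.ne h

theorem integrableOn_exp_mul_erlangDiff {N : ℕ} (hN : 0 < N) {Γ s : ℝ} (hΓ : 0 < Γ)
    (hs : 0 < 1 - Γ * s) (n : ℕ) :
    IntegrableOn (fun t => Real.exp (s * t) * erlangDiff N Γ t n) (Set.Ioi 0) := by
  simp only [erlangDiff, Finset.mul_sum, mul_left_comm (Real.exp _)]
  exact integrable_finsetSum _ fun m _ =>
    (integrableOn_exp_mul_erlangPdf hN hΓ hs (n - m)).const_mul _

/-- The alternating binomial sum collapses to a power of `-1 + 1/(1 - Γs) = Γs/(1 - Γs)`. -/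
theorem integral_exp_mul_erlangDiff {N : ℕ} (hN : 0 < N) {Γ s : ℝ} (hΓ : 0 < Γ)
    (hs : 0 < 1 - Γ * s) (n : ℕ) :
    ∫ t in Set.Ioi 0, Real.exp (s * t) * erlangDiff N Γ t n =
      1 / (1 - Γ * s) ^ N * (Γ * s / (1 - Γ * s)) ^ n := by
  simp only [erlangDiff, Finset.mul_sum, mul_left_comm (Real.exp _)]
  rw [integral_finsetSum _ fun m _ =>
    (integrableOn_exp_mul_erlangPdf hN hΓ hs (n - m)).const_mul _]
  simp only [integral_const_mul, integral_exp_mul_erlangPdf hN hΓ hs]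
  have e : Γ * s / (1 - Γ * s) = -1 + 1 / (1 - Γ * s) := by field_simp; ring
  rw [e, add_pow, Finset.mul_sum]
  refine Finset.sum_congr rfl fun m _ => ?_
  rw [pow_add, one_div_pow]
  ring

/-- The same binomial sum without signs. The bound is geometric in `n`, so the `1/n!` in
`kummerTerm` makes the `L¹` norms summable and justifies exchanging sum and integral. -/
theorem integral_norm_exp_mul_erlangDiff_le {N : ℕ} (hN : 0 < N) {Γ s : ℝ} (hΓ : 0 < Γ)
    (hs : 0 < 1 - Γ * s) (n : ℕ) :
    ∫ t in Set.Ioi 0, ‖Real.exp (s * t) * erlangDiff N Γ t n‖ ≤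
      1 / (1 - Γ * s) ^ N * (1 + 1 / (1 - Γ * s)) ^ n := by
  have hint : ∀ m ∈ Finset.range (n + 1), IntegrableOn (fun t => (n.choose m : ℝ) *
      (Real.exp (s * t) * erlangPdf N Γ t (n - m))) (Set.Ioi 0) := fun m _ =>
    (integrableOn_exp_mul_erlangPdf hN hΓ hs (n - m)).const_mul _
  calc _ ≤ ∫ t in Set.Ioi 0, ∑ m ∈ Finset.range (n + 1), (n.choose m : ℝ) *
        (Real.exp (s * t) * erlangPdf N Γ t (n - m)) := by
        refine setIntegral_mono_on (integrableOn_exp_mul_erlangDiff hN hΓ hs n).norm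
          (integrable_finsetSum _ hint) measurableSet_Ioi fun t ht => ?_
        rw [erlangDiff, Finset.mul_sum]
        refine norm_sum_le_of_le _ fun m _ => ?_
        have h0 := erlangPdf_nonneg N hΓ (le_of_lt ht) (n - m)
        rw [norm_mul, norm_mul, norm_mul, norm_pow, norm_neg, norm_one, one_pow, mul_one,
          Real.norm_of_nonneg h0, Real.norm_of_nonneg (Real.exp_nonneg _),
          Real.norm_of_nonneg (Nat.cast_nonneg _)]
        exact le_of_eq (by ring)
    _ = _ := by
        rw [integral_finsetSum _ hint]
        simp only [integral_const_mul, integral_exp_mul_erlangPdf hN hΓ hs]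
        rw [add_pow, Finset.mul_sum]
        refine Finset.sum_congr rfl fun m _ => ?_
        rw [pow_add, one_div_pow, one_pow]
        ring

theorem integrable_tsum_of_summable_integral_norm {α E : Type*} [MeasurableSpace α]
    [NormedAddCommGroup E] {μ : Measure α} {F : ℕ → α → E} (hF : ∀ n, Integrable (F n) μ)
    (hs : Summable fun n => ∫ x, ‖F n x‖ ∂μ)
    (hm : AEStronglyMeasurable (fun x => ∑' n, F n x) μ) :
    Integrable (fun x => ∑' n, F n x) μ := by
  refine ⟨hm, ?_⟩
  calc ∫⁻ x, ‖∑' n, F n x‖ₑ ∂μ ≤ ∫⁻ x, ∑' n, ‖F n x‖ₑ ∂μ :=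
        lintegral_mono fun x => enorm_tsum_le_tsum_enorm
    _ = ∑' n, ∫⁻ x, ‖F n x‖ₑ ∂μ := lintegral_tsum fun n => (hF n).1.enorm
    _ = ∑' n, ENNReal.ofReal (∫ x, ‖F n x‖ ∂μ) :=
        tsum_congr fun n => (ofReal_integral_norm_eq_lintegral_enorm (hF n)).symm
    _ < ⊤ := hs.tsum_ofReal_lt_top

theorem continuous_zfPdf {N NR : ℕ} (hN : 0 < N) (h : N ≤ NR) (Γ a : ℝ) :
    Continuous fun t => zfPdf N NR Γ t a := by
  simp only [zfPdf_eq_mul_seriesSum hN h]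
  have h1 := ((factorialDecay_timeCoeff hN h Γ a).contDiff 0).continuous
  have h2 : Continuous fun t : ℝ => NormedSpace.exp (-t / Γ) :=
    NormedSpace.exp_continuous.comp (by fun_prop)
  fun_prop

theorem integral_exp_mul_zfPdf {N NR : ℕ} (hN : 0 < N) (h : N ≤ NR) {Γ s : ℝ} (hΓ : 0 < Γ)
    (hs : 0 < 1 - Γ * s) (a : ℝ) :
    IntegrableOn (fun t => Real.exp (s * t) * zfPdf N NR Γ t a) (Set.Ioi 0) ∧
      ∫ t in Set.Ioi 0, Real.exp (s * t) * zfPdf N NR Γ t a = zfMgf N NR Γ s a := by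
  set F : ℕ → ℝ → ℝ := fun n t =>
    kummerTerm N NR n a * (Real.exp (s * t) * erlangDiff N Γ t n) with hF
  have hFint : ∀ n, Integrable (F n) (volume.restrict (Set.Ioi 0)) := fun n =>
    (integrableOn_exp_mul_erlangDiff hN hΓ hs n).const_mul _
  have hsum : Summable fun n => ∫ t in Set.Ioi 0, ‖F n t‖ := by
    refine Summable.of_nonneg_of_le (fun n => integral_nonneg fun t => norm_nonneg _) (fun n => ?_)
      ((Real.summable_pow_div_factorial (‖a‖ * (1 + 1 / (1 - Γ * s)))).mul_left
        (1 / (1 - Γ * s) ^ N))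
    simp only [hF, norm_mul (kummerTerm N NR n a), integral_const_mul]
    refine (mul_le_mul (norm_kummerTerm_le h n a)
      (integral_norm_exp_mul_erlangDiff_le hN hΓ hs n)
      (integral_nonneg fun t => norm_nonneg _) (by positivity)).trans_eq ?_
    rw [mul_pow]
    ring
  have hfun : (fun t => Real.exp (s * t) * zfPdf N NR Γ t a) = fun t => ∑' n, F n t := by
    ext t
    rw [zfPdf_eq_tsum, ← tsum_mul_left]
    exact tsum_congr fun n => by simp only [hF]; ring
  have hcont : Continuous fun t => Real.exp (s * t) * zfPdf N NR Γ t a :=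
    (by fun_prop : Continuous fun t : ℝ => Real.exp (s * t)).mul (continuous_zfPdf hN h Γ a)
  constructor
  · have hm := hcont.aestronglyMeasurable (μ := volume.restrict (Set.Ioi 0))
    rw [hfun] at hm ⊢
    exact integrable_tsum_of_summable_integral_norm hFint hsum hm
  · rw [hfun, ← (hasSum_integral_of_summable_integral_norm hFint hsum).tsum_eq, zfMgf, kummer,
      ← tsum_mul_left]
    refine tsum_congr fun n => ?_
    simp only [hF, integral_const_mul, integral_exp_mul_erlangDiff hN hΓ hs, kummerTerm_eq, mul_pow]
    ring

theorem isZfSnrLaw_withDensity {N NR : ℕ} (hN : 0 < N) (h : N ≤ NR) {Γ a : ℝ} (hΓ : 0 < Γ)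
    (ha : 0 ≤ a) :
    IsZfSnrLaw N NR Γ a ((volume.restrict (Set.Ioi 0)).withDensity
      (fun t => ENNReal.ofReal (zfPdf N NR Γ t a))) := by
  have hmeas : Measurable fun t => (zfPdf N NR Γ t a).toNNReal :=
    (continuous_zfPdf hN h Γ a).measurable.real_toNNReal
  have hpos : ∀ t ∈ Set.Ioi (0 : ℝ), 0 ≤ zfPdf N NR Γ t a := fun t ht =>
    zfPdf_nonneg hN h hΓ ha (le_of_lt ht)
  have key : ∀ s : ℝ, ∀ t ∈ Set.Ioi (0 : ℝ),
      (zfPdf N NR Γ t a).toNNReal • Real.exp (s * t) = Real.exp (s * t) * zfPdf N NR Γ t a := by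
    intro s t ht
    rw [NNReal.smul_def, Real.coe_toNNReal _ (hpos t ht), smul_eq_mul, mul_comm]
  refine ⟨⟨?_⟩, fun s hs => ?_⟩
  -- The total mass is the m.g.f. at `s = 0`, which equals `1`.
  · have h0 := integral_exp_mul_zfPdf hN h (s := 0) hΓ (by simp) a
    simp only [zero_mul, Real.exp_zero, one_mul] at h0
    rw [withDensity_apply _ MeasurableSet.univ, setLIntegral_univ,
      ← ofReal_integral_eq_lintegral_ofReal h0.1
        ((ae_restrict_iff' measurableSet_Ioi).2 (ae_of_all _ hpos)), h0.2]
    simp [zfMgf, kummer_apply_zero]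
  · have hs' : 0 < 1 - Γ * s := by
      rw [lt_div_iff₀ hΓ] at hs
      linarith
    obtain ⟨h1, h2⟩ := integral_exp_mul_zfPdf hN h hΓ hs' a
    constructor
    · change Integrable _ ((volume.restrict (Set.Ioi 0)).withDensity
        fun t => ((zfPdf N NR Γ t a).toNNReal : ENNReal))
      rw [integrable_withDensity_iff_integrable_smul hmeas]
      exact h1.congr_fun (fun t ht => (key s t ht).symm) measurableSet_Ioi
    · rw [mgf, ← h2]
      change ∫ t, Real.exp (s * t) ∂((volume.restrict (Set.Ioi 0)).withDensity
        fun t => ((zfPdf N NR Γ t a).toNNReal : ENNReal)) = _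
      rw [integral_withDensity_eq_integral_smul hmeas]
      exact setIntegral_congr_fun measurableSet_Ioi (key s)

end Laplace

/-! ### Uniqueness -/

/-- Two finite measures whose moment generating functions exist and agree on a neighbourhood of `0`
are equal. -/
theorem MeasureTheory.Measure.ext_of_mgf_eqOn_nhds {μ ν : Measure ℝ} [IsFiniteMeasure μ]
    [IsFiniteMeasure ν] {U : Set ℝ} (hU : IsOpen U) (h0 : (0 : ℝ) ∈ U) (hconv : Convex ℝ U)
    (hμ : U ⊆ integrableExpSet id μ) (hν : U ⊆ integrableExpSet id ν)
    (h : Set.EqOn (mgf id μ) (mgf id ν) U) : μ = ν := by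
  have hX : AnalyticOnNhd ℂ (complexMGF id μ) {z | z.re ∈ U} := fun z hz =>
    analyticAt_complexMGF (interior_maximal hμ hU hz)
  have hY : AnalyticOnNhd ℂ (complexMGF id ν) {z | z.re ∈ U} := fun z hz =>
    analyticAt_complexMGF (interior_maximal hν hU hz)
  -- The identity theorem: agreement at real points accumulating at `0` spreads over the strip,
  -- which contains the imaginary axis, where the characteristic functions live.
  have heq : Set.EqOn (complexMGF id μ) (complexMGF id ν) {z | z.re ∈ U} := by
    refine hX.eqOn_of_preconnected_of_frequently_eq hY
      (hconv.linear_preimage Complex.reLm).isPreconnected (z₀ := ((0 : ℝ) : ℂ)) (by simpa using h0) ?_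
    have h_real : ∃ᶠ x : ℝ in nhdsWithin 0 {0}ᶜ, complexMGF id μ x = complexMGF id ν x := by
      refine Filter.Eventually.frequently (eventually_nhdsWithin_of_eventually_nhds ?_)
      filter_upwards [hU.mem_nhds h0] with x hx
      rw [complexMGF_ofReal, complexMGF_ofReal, h hx]
    refine Filter.Tendsto.frequently ?_ h_real
    refine tendsto_nhdsWithin_iff.2 ⟨?_, ?_⟩
    · exact (Complex.continuous_ofReal.tendsto 0).mono_left nhdsWithin_le_nhds
    · filter_upwards [self_mem_nhdsWithin] with x hx
      simpa using hx
  refine Measure.ext_of_charFun (funext fun t => ?_)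
  rw [← complexMGF_id_mul_I, ← complexMGF_id_mul_I]
  exact heq (by simpa using h0)

theorem IsZfSnrLaw.unique {N NR : ℕ} {Γ a : ℝ} (hΓ : 0 < Γ) {μ ν : Measure ℝ}
    (hμ : IsZfSnrLaw N NR Γ a μ) (hν : IsZfSnrLaw N NR Γ a ν) : μ = ν := by
  have := hμ.1
  have := hν.1
  exact Measure.ext_of_mgf_eqOn_nhds isOpen_Iio (Set.mem_Iio.2 (one_div_pos.2 hΓ)) (convex_Iio _)
    (fun s hs => (hμ.2 s hs).1) (fun s hs => (hν.2 s hs).1)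
    fun s hs => (hμ.2 s hs).2.trans (hν.2 s hs).2.symm

theorem lemma1 {𝕜 : Type*} [RCLike 𝕜] (N NT NR : ℕ) (hNT : 1 ≤ NT) (hNR : NT ≤ NR)
    (hN : N = NR - NT + 1) (Γ₁ : ℝ) (hΓ₁ : 0 < Γ₁) :
    IsHolonomic (fun s a : 𝕜 => zfMgf N NR (Γ₁ : 𝕜) s a) {q | 1 - (Γ₁ : 𝕜) * q.1 ≠ 0} ∧
    IsHolonomic (fun t a : 𝕜 => zfPdf N NR (Γ₁ : 𝕜) t a) Set.univ ∧
    ∀ a : ℝ, 0 ≤ a →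
      (∀ t : ℝ, 0 < t → 0 ≤ zfPdf N NR Γ₁ t a) ∧
      ∀ μ : Measure ℝ, IsZfSnrLaw N NR Γ₁ a μ ↔
        μ = (volume.restrict (Set.Ioi 0)).withDensity
          (fun t => ENNReal.ofReal (zfPdf N NR Γ₁ t a)) := by
  have hpos : 0 < N := by lia
  have hle : N ≤ NR := by lia
  have hΓ : (Γ₁ : 𝕜) ≠ 0 := RCLike.ofReal_ne_zero.2 hΓ₁.ne'
  refine ⟨⟨isHolonomicFst_zfMgf (hpos.trans_le hle) hle hΓ,
    isHolonomicFst_zfMgf_swap (hpos.trans_le hle) hle _⟩,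
    ⟨isHolonomicFst_zfPdf hpos hle _, isHolonomicFst_zfPdf_swap hpos hle hΓ⟩, fun a ha =>
    ⟨fun t ht => zfPdf_nonneg hpos hle hΓ₁ ha ht.le, fun μ => ⟨fun hμ => ?_, ?_⟩⟩⟩
  · exact hμ.unique hΓ₁ (isZfSnrLaw_withDensity hpos hle hΓ₁ ha)
  · rintro rfl
    exact isZfSnrLaw_withDensity hpos hle hΓ₁ ha
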